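/- Let $n\ge 1$ be an integer and let $\frac cd$ be a rational number in lowest terms ($c,d$ positive integers, $\gcd(c,d)=1$) with $0<\frac cd<n$. For real $r$ let \[\Delta_{r,n}=\{x\in\mathbb R^n \mid x_1+\cdots+x_n=r,\ 0\le x_i\le 1 \text{ for all } i\}.\] For a polytope contained in a hyperplane $x_1+\cdots+x_n=\mathrm{const}$ of $\mathbb R^n$, its normalized volume is its $(n-1)$-dimensional volume, in the unit for which the standard simplex $\Delta_{1,n}$ has volume $1$. A circular permutation of $\{0,1,\dots,m\}$ is a word containing each of $0,1,\dots,m$ exactly once, considered up to cyclic shift; a cyclic descent of it is a pair of cyclically consecutive letters $a,b$ ($b$ immediately following $a$) with $a>b$. For a positive integer $d$ dividing $m+1$, let the refined Eulerian number $\left\langle{m\atop k}\right\rangle_d$ be the number of circular permutations of $\{0,1,\dots,m\}$ that have exactly $k+1$ cyclic descents and are fixed by adding $\frac{m+1}{d}$ modulo $m+1$ to every letter. Then the slice $\{x\in[0,d]^n \mid x_1+\cdots+x_n=c\}$ equals $d\,\Delta_{\frac cd,n}$, and its normalized volume is \[\left\langle{dn-1\atop c-1}\right\rangle_d ,\] the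 number of circular permutations of $\{0,1,\dots,dn-1\}$ with exactly $c$ cyclic descents that are fixed by adding $n$ modulo $dn$ to every letter. -/

import Mathlib

open scoped Pointwise ENNReal MeasureTheory

/-- The slice `Δ_{r,n}` of the unit cube `[0,1]^n` by the hyperplane `x_1 + ⋯ + x_n = r`. -/
def hypersimplex (r : ℝ) (n : ℕ) : Set (EuclideanSpace ℝ (Fin n)) :=
  {x | ∑ i, x i = r ∧ ∀ i, x i ∈ Set.Icc (0 : ℝ) 1}

/-- The normalized volume of a set `P` contained in a hyperplane `x_1 + ⋯ + x_n = const` of `ℝ^n`: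
its `(n-1)`-dimensional Euclidean volume, in the unit for which the standard simplex `Δ_{1,n}` has
volume `1`. (`(n-1)`-dimensional volume is `(n-1)`-dimensional Hausdorff measure up to a constant
factor, which cancels in the quotient.) -/
noncomputable def normalizedVolume {n : ℕ} (P : Set (EuclideanSpace ℝ (Fin n))) : ℝ≥0∞ :=
  μH[((n - 1 : ℕ) : ℝ)] P / μH[((n - 1 : ℕ) : ℝ)] (hypersimplex 1 n)

/-- Two words `w 0, w 1, …, w (N - 1)`, each listing all of `{0, …, N - 1}` once, are equivalent if
they differ by a cyclic shift. Positions and letters are both indexed by `ZMod N`. -/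
def cyclicShiftSetoid (N : ℕ) : Setoid (Equiv.Perm (ZMod N)) where
  r w w' := ∃ s : ZMod N, ∀ i, w' i = w (i + s)
  iseqv :=
    { refl := fun w => ⟨0, fun i => by rw [add_zero]⟩
      symm := by
        rintro w w' ⟨s, h⟩
        exact ⟨-s, fun i => by rw [h, neg_add_cancel_right]⟩
      trans := by
        rintro w w' w'' ⟨s, h⟩ ⟨t, h'⟩
        exact ⟨t + s, fun i => by rw [h', h, add_assoc]⟩ }

/-- Circular permutations of `{0, …, N - 1}` (for `N > 0`): permutations up to cyclic shift. -/
def CircularPerm (N : ℕ) : Type := Quotient (cyclicShiftSetoid N)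

namespace CircularPerm

/-- The number of cyclic descents: positions `i`, read cyclically, at which the letter in position
`i` is larger (as an integer in `{0, …, N - 1}`) than the letter in position `i + 1`. -/
noncomputable def cyclicDescents {N : ℕ} : CircularPerm N → ℕ :=
  Quotient.lift (s := cyclicShiftSetoid N)
    (fun w => Nat.card {i : ZMod N // (w (i + 1)).val < (w i).val}) <| by
      rintro w w' ⟨s, h⟩
      refine (Nat.card_congr ((Equiv.addRight s).subtypeEquiv fun i => ?_)).symm
      rw [h, h, Equiv.coe_addRight, add_right_comm]

/-- Add `a` modulo `N` to every letter of a circular permutation. -/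
def addLetters {N : ℕ} (a : ZMod N) : CircularPerm N → CircularPerm N :=
  Quotient.map' (s₁ := cyclicShiftSetoid N) (s₂ := cyclicShiftSetoid N)
    (fun w => w.trans (Equiv.addRight a)) <| by
      rintro w w' ⟨s, h⟩
      exact ⟨s, fun i => by simp [h]⟩

end CircularPerm

/-- The refined Eulerian number `⟨m, k⟩_d`, for `d` dividing `m + 1`: the number of circular
permutations of `{0, …, m}` with `k + 1` cyclic descents that are fixed by adding `(m + 1) / d`
modulo `m + 1` to every letter. -/
noncomputable def refinedEulerian (d m k : ℕ) : ℕ :=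
  Nat.card {σ : CircularPerm (m + 1) //
    σ.cyclicDescents = k + 1 ∧ σ.addLetters (((m + 1) / d : ℕ) : ZMod (m + 1)) = σ}

/-!
The slice of `[0, d]^n` by `x_1 + ⋯ + x_n = c` is cut by the hyperplanes on which some sum
`x_i + ⋯ + x_j` is an integer into alcoves, all of the same volume as the standard simplex; so its
normalized volume is the number of its alcoves, and these are in bijection with the circular
permutations in question.

Write `n = m + 1` and use the partial sums `y ∈ ℝ^m` of `x` as coordinates. They identify each
hyperplane `x_1 + ⋯ + x_n = c` with `ℝ^m` by an affine map whose linear part does not depend on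
`c`, so that Hausdorff measure becomes one fixed multiple of Lebesgue measure
(`exists_hausdorffMeasure_image_ofPartialSums`), which cancels in the normalized volume. A generic
`y` is recorded by its integer parts `q` and by the order `ρ` of its fractional parts. The points
with given `(q, ρ)` form an alcove; each is the image of `0 < a_0 < ⋯ < a_{m-1} < 1` under a
permutation of the coordinates and a translation (`volume_alcove`), and the standard simplex is,
up to a null set, the alcove `q = 0`, `ρ = 1` (`volume_partialSumPolytope_one_one`).

Replace a partial sum with integer part `q` and fractional part of rank `r` by the integer
`n q + r`. Extended by `W (i + n) = W i + c n`, this gives an integer sequence whose order relations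
with shifts by multiples of `n` are those of the partial sums with integer shifts
(`periodicExt_le_iff_alcoveSeq_le`). Hence the alcove lies in the slice exactly if
`0 < W (i + 1) - W i < d n` for all `i`, i.e. if `W` is a ladder (`IsLadder`), and
`volume_partialSumPolytope` counts ladders.

Reducing a ladder modulo `d n` gives a word `w` over `ℤ / d n` with `w (i + n) = w i + c n`. As `c`
is a unit modulo `d`, it is a permutation and its cyclic class is fixed by adding `n`. Its steps,
read in `{0, …, d n - 1}`, are the steps of the ladder, which add up to `c` times `d n`; so it has
`c` cyclic descents (`sum_val_sub_eq_mul_descents`). Conversely, if the class of `w` is fixed by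
adding `n`, then `w (i + s) = w i + n` for some `s` of order `d`, which generates the same subgroup
as `n`; so the steps of `w` are `n`-periodic, and summing them recovers a ladder
(`ladderCircularPerm_surjective`).
-/

open MeasureTheory

/-! ### Cyclic descents as winding numbers -/

theorem ZMod.sum_range_natCast {M : Type*} [AddCommMonoid M] (N : ℕ) [NeZero N]
    (f : ZMod N → M) : ∑ j ∈ Finset.range N, f (j : ZMod N) = ∑ x, f x := by
  refine Finset.sum_nbij' (fun j => (j : ZMod N)) ZMod.val ?_ ?_ ?_ ?_ ?_
  · simp
  · intro x _
    simpa using ZMod.val_lt x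
  · intro j hj
    exact ZMod.val_cast_of_lt (by simpa using hj)
  · intro x _
    exact ZMod.natCast_zmod_val x
  · simp

theorem ZMod.intCast_val_sub {N : ℕ} [NeZero N] (a b : ZMod N) :
    ((a - b).val : ℤ) = a.val - b.val + N * (if a.val < b.val then 1 else 0) := by
  split_ifs with h
  · have hb := ZMod.val_sub h.le
    have hab : b - a ≠ 0 := fun h0 => by
      rw [sub_eq_zero] at h0
      simp [h0] at h
    have : NeZero (b - a) := ⟨hab⟩
    have := ZMod.val_neg_of_ne_zero (b - a)
    rw [neg_sub] at this
    have := ZMod.val_lt b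
    omega
  · have := ZMod.val_sub (not_lt.mp h)
    omega

/-- The steps `w (i + 1) - w i`, read in `{0, …, N - 1}`, go around `ℤ / N` once for each cyclic
descent of `w`. -/
theorem sum_val_sub_eq_mul_descents {N : ℕ} [NeZero N] (w : ZMod N → ZMod N) :
    ∑ i, ((w (i + 1) - w i).val : ℤ) =
      N * (Nat.card {i : ZMod N // (w (i + 1)).val < (w i).val} : ℤ) := by
  have hsum : ∑ i, ((w (i + 1)).val : ℤ) = ∑ i, ((w i).val : ℤ) :=
    Equiv.sum_comp (Equiv.addRight (1 : ZMod N)) fun i => ((w i).val : ℤ)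
  simp_rw [ZMod.intCast_val_sub]
  rw [Finset.sum_add_distrib, Finset.sum_sub_distrib, hsum, sub_self, zero_add,
    ← Finset.mul_sum, Nat.card_eq_fintype_card, Fintype.card_subtype]
  simp

/-! ### Ladders and circular permutations -/

/-- A ladder: an integer sequence `0 = W 0 < W 1 < ⋯` whose steps are less than `d n`, which
increases by `c n` over each period of length `n`, and whose terms within a period are
incongruent modulo `n`. -/
structure IsLadder (n c d : ℕ) (W : ℕ → ℤ) : Prop where
  zero : W 0 = 0
  add_period : ∀ i, W (i + n) = W i + c * n
  lt_succ : ∀ i, W i < W (i + 1)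
  succ_lt : ∀ i, W (i + 1) < W i + d * n
  modEq : ∀ i j, (n : ℤ) ∣ W i - W j → i ≡ j [MOD n]

namespace IsLadder

variable {n c d : ℕ} {W : ℕ → ℤ}

theorem add_mul_period (h : IsLadder n c d W) (i k : ℕ) : W (i + n * k) = W i + k * c * n := by
  induction k with
  | zero => simp
  | succ k ih =>
    rw [mul_add, mul_one, ← add_assoc, h.add_period, ih]
    push_cast
    ring

theorem cast_mod (h : IsLadder n c d W) (i : ℕ) :
    (W (i % (d * n)) : ZMod (d * n)) = W i := by
  have h1 : W i = W (i % (d * n)) + (d * (i / (d * n)) : ℕ) * c * n := by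
    rw [← h.add_mul_period, ← mul_assoc, mul_comm n d, Nat.mod_add_div]
  have h2 : (d : ZMod (d * n)) * (n : ZMod (d * n)) = 0 := by
    exact_mod_cast ZMod.natCast_self (d * n)
  rw [h1]
  generalize i / (d * n) = k
  push_cast
  linear_combination -(k * c : ZMod (d * n)) * h2

/-- The word of a ladder: its terms modulo `d n`. -/
def word (n d : ℕ) (W : ℕ → ℤ) (x : ZMod (d * n)) : ZMod (d * n) := W x.val

theorem word_natCast (h : IsLadder n c d W) (i : ℕ) :
    word n d W (i : ZMod (d * n)) = W i := by
  rw [word, ZMod.val_natCast, h.cast_mod]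

variable [NeZero (d * n)]

theorem word_injective (hcd : Nat.Coprime c d) (h : IsLadder n c d W) :
    Function.Injective (word n d W) := by
  have hn : n ≠ 0 := fun h0 => NeZero.ne (d * n) (by simp [h0])
  -- Terms with `j ≤ i` that agree modulo `d n` are a multiple of `d` periods apart.
  have key : ∀ i j : ℕ, j ≤ i → (W i : ZMod (d * n)) = W j → i ≡ j [MOD d * n] := by
    intro i j hij hW
    have h1 : ((d * n : ℕ) : ℤ) ∣ W i - W j := by
      rw [← ZMod.intCast_zmod_eq_zero_iff_dvd]
      · push_cast; rw [hW, sub_self]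
    have h2 : i ≡ j [MOD n] := h.modEq i j (dvd_trans (by simp) h1)
    obtain ⟨k, hk⟩ := (Nat.modEq_iff_dvd' hij).mp h2.symm
    obtain rfl : i = j + n * k := by omega
    rw [h.add_mul_period, add_sub_cancel_left] at h1
    have h3 : d * n ∣ k * c * n := by exact_mod_cast h1
    have h4 : d ∣ k := hcd.symm.dvd_of_dvd_mul_right
      (Nat.dvd_of_mul_dvd_mul_right (Nat.pos_of_ne_zero hn) h3)
    refine ((Nat.modEq_iff_dvd' hij).mpr ?_).symm
    rw [hk, mul_comm d n]
    exact mul_dvd_mul_left n h4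
  intro x y hxy
  rw [← ZMod.natCast_zmod_val x, ← ZMod.natCast_zmod_val y, ZMod.natCast_eq_natCast_iff]
  rcases le_total y.val x.val with hle | hle
  · exact key _ _ hle hxy
  · exact (key _ _ hle hxy.symm).symm

/-- The word of a ladder as a permutation of `ℤ / d n`. -/
noncomputable def perm (hcd : Nat.Coprime c d) (h : IsLadder n c d W) :
    Equiv.Perm (ZMod (d * n)) :=
  Equiv.ofBijective (word n d W) (Finite.injective_iff_bijective.mp (h.word_injective hcd))

theorem perm_natCast (hcd : Nat.Coprime c d) (h : IsLadder n c d W) (i : ℕ) :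
    h.perm hcd (i : ZMod (d * n)) = W i :=
  h.word_natCast i

theorem perm_zero (hcd : Nat.Coprime c d) (h : IsLadder n c d W) : h.perm hcd 0 = 0 := by
  have := h.perm_natCast hcd 0
  rwa [h.zero, Nat.cast_zero, Int.cast_zero] at this

theorem val_step (hcd : Nat.Coprime c d) (h : IsLadder n c d W) (i : ℕ) :
    ((h.perm hcd ((i : ZMod (d * n)) + 1) - h.perm hcd i).val : ℤ) = W (i + 1) - W i := by
  have h1 := h.perm_natCast hcd (i + 1)
  push_cast at h1
  have h2 : h.perm hcd ((i : ZMod (d * n)) + 1) - h.perm hcd i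
      = ((W (i + 1) - W i : ℤ) : ZMod (d * n)) := by
    rw [h1, h.perm_natCast]; push_cast; rfl
  rw [h2, ZMod.val_intCast, Int.emod_eq_of_lt]
  · have := h.lt_succ i; omega
  · have := h.succ_lt i; push_cast; omega

theorem descents (hcd : Nat.Coprime c d) (h : IsLadder n c d W) :
    Nat.card {i // (h.perm hcd (i + 1)).val < (h.perm hcd i).val} = c := by
  have h1 := sum_val_sub_eq_mul_descents (h.perm hcd)
  rw [← ZMod.sum_range_natCast] at h1
  simp_rw [h.val_step] at h1
  have h2 : W (d * n) = d * c * n := by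
    have := h.add_mul_period 0 d
    rwa [zero_add, mul_comm, h.zero, zero_add] at this
  rw [Finset.sum_range_sub, h.zero, h2, sub_zero] at h1
  have h3 : ((d * n : ℕ) : ℤ) ≠ 0 := by exact_mod_cast NeZero.ne (d * n)
  have h4 : ((d * n : ℕ) : ℤ) * c = (d * n : ℕ) *
      (Nat.card {i // (h.perm hcd (i + 1)).val < (h.perm hcd i).val} : ℤ) := by
    rw [← h1]; push_cast; ring
  exact_mod_cast (mul_left_cancel₀ h3 h4).symm

theorem exists_shift (hcd : Nat.Coprime c d) (h : IsLadder n c d W) :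
    ∃ s, ∀ x, h.perm hcd x + n = h.perm hcd (x + s) := by
  have hd : d ≠ 0 := fun h0 => NeZero.ne (d * n) (by simp [h0])
  -- `t` periods increase the ladder by `t c n`, which is `n` modulo `d n`.
  obtain ⟨t, ht⟩ : ∃ t, t * c ≡ 1 [MOD d] := by
    rcases Nat.lt_or_ge 1 d with h1 | h1
    · obtain ⟨t, -, ht⟩ := Nat.exists_mul_mod_eq_one_of_coprime hcd h1
      refine ⟨t, ?_⟩
      rw [mul_comm]
      exact ht.trans (Nat.mod_eq_of_lt h1).symm
    · obtain rfl : d = 1 := by omega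
      exact ⟨0, Nat.modEq_one⟩
  refine ⟨(n * t : ℕ), fun x => ?_⟩
  rw [← ZMod.natCast_zmod_val x, ← Nat.cast_add, h.perm_natCast, h.perm_natCast,
    h.add_mul_period]
  have h2 : ((t * c * n : ℕ) : ZMod (d * n)) = ((1 * n : ℕ) : ZMod (d * n)) := by
    rw [ZMod.natCast_eq_natCast_iff]
    exact Nat.ModEq.mul_right' n ht
  push_cast at h2 ⊢
  rw [h2, one_mul]

end IsLadder

/-- The circular permutation of a ladder. -/
noncomputable def ladderCircularPerm {n c d : ℕ} [NeZero (d * n)] (hcd : Nat.Coprime c d)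
    (W : {W // IsLadder n c d W}) :
    {σ : CircularPerm (d * n) //
      σ.cyclicDescents = c ∧ σ.addLetters ((n : ℕ) : ZMod (d * n)) = σ} :=
  ⟨Quotient.mk (cyclicShiftSetoid (d * n)) (W.2.perm hcd), W.2.descents hcd, by
    obtain ⟨s, hs⟩ := W.2.exists_shift hcd
    refine Quotient.sound (s := cyclicShiftSetoid (d * n)) ?_
    exact Setoid.symm' (cyclicShiftSetoid (d * n)) ⟨s, fun i => hs i⟩⟩

theorem ladderCircularPerm_injective {n c d : ℕ} [NeZero (d * n)] (hcd : Nat.Coprime c d) :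
    Function.Injective (ladderCircularPerm (n := n) hcd) := by
  rintro ⟨W, h⟩ ⟨W', h'⟩ heq
  have h1 : Quotient.mk (cyclicShiftSetoid (d * n)) (h.perm hcd) =
      Quotient.mk (cyclicShiftSetoid (d * n)) (h'.perm hcd) := congrArg Subtype.val heq
  obtain ⟨s, hs⟩ := Quotient.exact h1
  -- Both words have the letter `0` in position `0`, so the shift between them is trivial.
  have hs0 : s = 0 := by
    have := hs 0
    rw [h'.perm_zero, zero_add, ← h.perm_zero hcd] at this
    exact ((h.perm hcd).injective this).symm
  subst hs0
  have hperm : h'.perm hcd = h.perm hcd := Equiv.ext fun i => by rw [hs, add_zero]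
  have hW : ∀ i, W i = W' i := by
    intro i
    induction i with
    | zero => rw [h.zero, h'.zero]
    | succ i ih =>
      have h2 := h.val_step hcd i
      have h3 := h'.val_step hcd i
      rw [hperm] at h3
      linarith
  exact Subtype.ext (funext hW)

/-- The unwinding of a word over `ℤ / N` to an integer sequence, starting at `0`, whose steps are
the steps of the word, read in `{0, …, N - 1}`. -/
def unwind {N : ℕ} (w : ZMod N → ZMod N) (i : ℕ) : ℤ :=
  ∑ j ∈ Finset.range i, ((w ((j : ZMod N) + 1) - w j).val : ℤ)

theorem unwind_succ {N : ℕ} (w : ZMod N → ZMod N) (i : ℕ) :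
    unwind w (i + 1) = unwind w i + ((w ((i : ZMod N) + 1) - w i).val : ℤ) :=
  Finset.sum_range_succ _ _

theorem unwind_cast {N : ℕ} [NeZero N] {w : ZMod N → ZMod N} (hw : w 0 = 0) (i : ℕ) :
    (unwind w i : ZMod N) = w i := by
  induction i with
  | zero => simp [unwind, hw]
  | succ i ih =>
    rw [unwind_succ, Int.cast_add, ih]
    simp

theorem ladderCircularPerm_surjective {n c d : ℕ} [NeZero (d * n)] (hcd : Nat.Coprime c d)
    (hN : 1 < d * n) : Function.Surjective (ladderCircularPerm (n := n) hcd) := by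
  have hd : 0 < d := Nat.pos_of_ne_zero fun h0 => NeZero.ne (d * n) (by simp [h0])
  have hn : 0 < n := Nat.pos_of_ne_zero fun h0 => NeZero.ne (d * n) (by simp [h0])
  rintro ⟨σ, hdes, hfix⟩
  -- Choose the representative with the letter `0` in position `0`.
  obtain ⟨w, hw0, rfl⟩ : ∃ w : Equiv.Perm (ZMod (d * n)), w 0 = 0 ∧
      Quotient.mk (cyclicShiftSetoid (d * n)) w = σ := by
    obtain ⟨v, rfl⟩ := Quotient.exists_rep σ
    refine ⟨(Equiv.addRight (v.symm 0)).trans v, by simp, ?_⟩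
    refine Quotient.sound (s := cyclicShiftSetoid (d * n)) ?_
    exact Setoid.symm' (cyclicShiftSetoid (d * n)) ⟨v.symm 0, fun i => rfl⟩
  replace hdes : Nat.card {i : ZMod (d * n) // (w (i + 1)).val < (w i).val} = c := hdes
  obtain ⟨s, hs⟩ : ∃ s, ∀ x, w (x + s) = w x + n := by
    obtain ⟨s, hs⟩ := Quotient.exact
      (show Quotient.mk (cyclicShiftSetoid (d * n)) (w.trans (Equiv.addRight (n : ZMod (d * n)))) =
        Quotient.mk (cyclicShiftSetoid (d * n)) w from hfix)
    refine ⟨-s, fun x => ?_⟩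
    have := hs (x + -s)
    simp only [neg_add_cancel_right] at this
    rw [hs, neg_add_cancel_right]
    simp
  have hs' : ∀ (k : ℕ) x, w (x + k * s) = w x + k * n := by
    intro k
    induction k with
    | zero => simp
    | succ k ih =>
      intro x
      have : x + (k + 1 : ℕ) * s = (x + k * s) + s := by push_cast; ring
      rw [this, hs, ih]
      push_cast
      ring
  have hmul : ∀ k : ℕ, (k : ZMod (d * n)) * s = 0 ↔ d ∣ k := by
    intro k
    have h1 := hs' k 0
    rw [zero_add, hw0, zero_add] at h1
    constructor
    · intro h0
      rw [h0, hw0] at h1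
      have h2 : ((k * n : ℕ) : ZMod (d * n)) = 0 := by push_cast; exact h1.symm
      rw [ZMod.natCast_eq_zero_iff] at h2
      exact Nat.dvd_of_mul_dvd_mul_right hn h2
    · intro hk
      have h2 : ((k * n : ℕ) : ZMod (d * n)) = 0 := by
        rw [ZMod.natCast_eq_zero_iff]
        exact Nat.mul_dvd_mul_right hk n
      push_cast at h2
      rw [h2, ← hw0] at h1
      exact w.injective h1
  -- The shift `s` has order `d`, so it is `n` times a unit modulo `d`.
  obtain ⟨t, ht⟩ : ∃ t : ℕ, s = (n * t : ℕ) := by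
    have h1 : ((d * s.val : ℕ) : ZMod (d * n)) = 0 := by
      push_cast
      rw [ZMod.natCast_zmod_val]
      exact (hmul d).mpr dvd_rfl
    rw [ZMod.natCast_eq_zero_iff] at h1
    obtain ⟨t, ht⟩ := Nat.dvd_of_mul_dvd_mul_left hd h1
    exact ⟨t, by rw [← ht, ZMod.natCast_zmod_val]⟩
  have htd : Nat.Coprime t d := by
    obtain ⟨e, he⟩ := Nat.gcd_dvd_right t d
    obtain ⟨f, hf⟩ := Nat.gcd_dvd_left t d
    have h1 : (e : ZMod (d * n)) * s = 0 := by
      rw [ht, ← Nat.cast_mul, ZMod.natCast_eq_zero_iff]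
      refine ⟨f, ?_⟩
      rw [hf]
      conv_rhs => rw [he]
      ring
    have h2 : d ∣ e := (hmul e).mp h1
    have he0 : 0 < e := Nat.pos_of_ne_zero fun h0 => by simp [h0] at he; omega
    have h3 : t.gcd d * e ≤ 1 * e := by
      rw [← he, one_mul]
      exact Nat.le_of_dvd he0 h2
    have h4 := Nat.le_of_mul_le_mul_right h3 he0
    have h5 : 0 < t.gcd d := Nat.gcd_pos_of_pos_right t hd
    exact le_antisymm h4 h5
  obtain ⟨u, hu⟩ : ∃ u : ℕ, (u : ZMod (d * n)) * s = n := by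
    obtain ⟨u, hu⟩ : ∃ u, t * u ≡ 1 [MOD d] := by
      rcases Nat.lt_or_ge 1 d with h1 | h1
      · obtain ⟨u, -, hu⟩ := Nat.exists_mul_mod_eq_one_of_coprime htd h1
        exact ⟨u, hu.trans (Nat.mod_eq_of_lt h1).symm⟩
      · obtain rfl : d = 1 := by omega
        exact ⟨0, Nat.modEq_one⟩
    refine ⟨u, ?_⟩
    have h2 : ((t * u * n : ℕ) : ZMod (d * n)) = ((1 * n : ℕ) : ZMod (d * n)) := by
      rw [ZMod.natCast_eq_natCast_iff]
      exact Nat.ModEq.mul_right' n hu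
    rw [ht]
    push_cast at h2 ⊢
    linear_combination h2
  -- Hence the steps of the word are `n`-periodic.
  have hstep : ∀ x, w (x + n) = w x + u * n := fun x => by rw [← hu, hs', hu]
  have hper : ∀ i, unwind w (i + n) = unwind w i + unwind w n := by
    intro i
    induction i with
    | zero => simp [unwind]
    | succ i ih =>
      rw [add_right_comm, unwind_succ, ih, unwind_succ]
      have : w (((i + n : ℕ) : ZMod (d * n)) + 1) - w ((i + n : ℕ) : ZMod (d * n)) =
          w ((i : ZMod (d * n)) + 1) - w i := by
        push_cast
        rw [add_right_comm, hstep, hstep]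
        ring
      rw [this]
      ring
  have hperk : ∀ k : ℕ, unwind w (k * n) = k * unwind w n := by
    intro k
    induction k with
    | zero => simp [unwind]
    | succ k ih =>
      rw [add_mul, one_mul, hper, ih]
      push_cast
      ring
  -- The `d` periods of the word make `c` turns in all.
  have htotal : unwind w n = c * n := by
    have h1 := sum_val_sub_eq_mul_descents w
    rw [hdes, ← ZMod.sum_range_natCast] at h1
    have h2 := hperk d
    rw [unwind, h1] at h2
    push_cast at h2
    have h3 : (d : ℤ) ≠ 0 := by exact_mod_cast hd.ne'
    refine mul_left_cancel₀ h3 ?_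
    rw [← h2]
    ring
  have hne : (1 : ZMod (d * n)) ≠ 0 := by
    have : Fact (1 < d * n) := ⟨hN⟩
    exact one_ne_zero
  have hlad : IsLadder n c d (unwind w) :=
    { zero := by simp [unwind]
      add_period := fun i => by rw [hper, htotal]
      lt_succ := fun i => by
        rw [unwind_succ]
        have : w ((i : ZMod (d * n)) + 1) - w i ≠ 0 := fun h0 => by
          rw [sub_eq_zero, w.injective.eq_iff, add_eq_left] at h0
          exact hne h0
        have := (ZMod.val_ne_zero _).mpr this
        omega
      succ_lt := fun i => by
        rw [unwind_succ]
        have := ZMod.val_lt (w ((i : ZMod (d * n)) + 1) - w i)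
        have : ((w ((i : ZMod (d * n)) + 1) - w i).val : ℤ) < (d * n : ℕ) := by exact_mod_cast this
        push_cast at this
        linarith
      modEq := fun i j hij => by
        obtain ⟨k, hk⟩ := hij
        have h1 : (unwind w i : ZMod (d * n)) = unwind w j + k * n := by
          have : unwind w i = unwind w j + k * n := by linarith
          rw [this]
          push_cast
          rfl
        obtain ⟨k', hk'⟩ : ∃ k' : ℕ, (k : ZMod (d * n)) = k' :=
          ⟨(k : ZMod (d * n)).val, (ZMod.natCast_zmod_val _).symm⟩
        rw [unwind_cast hw0, unwind_cast hw0, hk', ← hs' k', w.injective.eq_iff, ht] at h1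
        have h2 : ((i : ℕ) : ZMod (d * n)) = ((j + n * (k' * t) : ℕ) : ZMod (d * n)) := by
          rw [h1]
          push_cast
          ring
        rw [ZMod.natCast_eq_natCast_iff] at h2
        have h3 := h2.of_mul_left d
        exact h3.trans (by simp [Nat.ModEq]) }
  refine ⟨⟨unwind w, hlad⟩, Subtype.ext ?_⟩
  refine congrArg (Quotient.mk (cyclicShiftSetoid (d * n))) (Equiv.ext fun x => ?_)
  rw [← ZMod.natCast_zmod_val x, hlad.perm_natCast, unwind_cast hw0]

theorem card_isLadder {n c d : ℕ} [NeZero (d * n)] (hcd : Nat.Coprime c d) (hN : 1 < d * n) :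
    ENat.card {W // IsLadder n c d W} =
      (Nat.card {σ : CircularPerm (d * n) //
        σ.cyclicDescents = c ∧ σ.addLetters ((n : ℕ) : ZMod (d * n)) = σ} : ℕ∞) := by
  rw [ENat.card_congr (Equiv.ofBijective (ladderCircularPerm (n := n) hcd)
    ⟨ladderCircularPerm_injective hcd, ladderCircularPerm_surjective hcd hN⟩)]
  have : Finite (CircularPerm (d * n)) :=
    inferInstanceAs (Finite (Quotient (cyclicShiftSetoid (d * n))))
  exact ENat.card_eq_coe_natCard _

/-! ### Quasi-periodic extensions -/

/-- The extension of `b 0, …, b m` to an infinite sequence that increases by `c` over each period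
of length `m + 1`. -/
def periodicExt {R : Type*} [Ring R] {m : ℕ} (b : Fin (m + 1) → R) (c : R) (k : ℕ) : R :=
  b ⟨k % (m + 1), Nat.mod_lt _ m.succ_pos⟩ + (k / (m + 1) : ℕ) * c

section PeriodicExt

variable {R : Type*} [Ring R] {m : ℕ} (b : Fin (m + 1) → R) (c : R)

theorem periodicExt_of_lt {k : ℕ} (hk : k < m + 1) : periodicExt b c k = b ⟨k, hk⟩ := by
  simp [periodicExt, Nat.mod_eq_of_lt hk, Nat.div_eq_of_lt hk]

theorem periodicExt_add_period (k : ℕ) :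
    periodicExt b c (k + (m + 1)) = periodicExt b c k + c := by
  simp only [periodicExt, Nat.add_mod_right, Nat.add_div_right k m.succ_pos]
  push_cast
  rw [add_mul, one_mul, add_assoc]

theorem periodicExt_zero : periodicExt b c 0 = b 0 := periodicExt_of_lt b c m.succ_pos

theorem periodicExt_period : periodicExt b c (m + 1) = b 0 + c := by
  have := periodicExt_add_period b c 0
  rwa [zero_add, periodicExt_zero] at this

theorem periodicExt_cons_succ (y : Fin m → R) {k : ℕ} (hk : k < m) :
    periodicExt (Fin.cons 0 y : Fin (m + 1) → R) c (k + 1) = y ⟨k, hk⟩ := by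
  rw [periodicExt_of_lt _ _ (Nat.succ_lt_succ hk)]
  rfl

/-- A sequence is determined by its quasi-periodicity and its terms in the first period. -/
theorem eq_periodicExt {W : ℕ → R} (hper : ∀ k, W (k + (m + 1)) = W k + c)
    (hW : ∀ j : Fin (m + 1), W j = b j) : W = periodicExt b c := by
  funext k
  induction k using Nat.strong_induction_on with
  | _ k ih =>
    rcases lt_or_ge k (m + 1) with hk | hk
    · rw [periodicExt_of_lt b c hk, ← hW ⟨k, hk⟩]
    · obtain ⟨l, rfl⟩ := Nat.exists_eq_add_of_le' hk
      rw [hper, periodicExt_add_period, ih l (by omega)]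

end PeriodicExt

/-! ### Alcoves -/

/-- The fundamental alcove `0 < a 0 < ⋯ < a (m - 1) < 1`. -/
def fundamentalAlcove (m : ℕ) : Set (Fin m → ℝ) :=
  {a | StrictMono a ∧ ∀ i, a i ∈ Set.Ioo (0 : ℝ) 1}

/-- The alcove of the points with integer parts `q` whose fractional parts are ordered by the
permutation `ρ`: the point `y` has coordinates `y i = q i + a (ρ i)` with `a` in the fundamental
alcove. -/
def alcove {m : ℕ} (q : Fin m → ℤ) (ρ : Equiv.Perm (Fin m)) : Set (Fin m → ℝ) :=
  {y | (fun i => y (ρ.symm i) - q (ρ.symm i)) ∈ fundamentalAlcove m}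

theorem isOpen_fundamentalAlcove (m : ℕ) : IsOpen (fundamentalAlcove m) := by
  simp only [fundamentalAlcove, StrictMono, Set.mem_Ioo, Set.ofPred_and, Set.ofPred_forall]
  refine IsOpen.inter ?_ ?_
  · exact isOpen_iInter_of_finite fun i => isOpen_iInter_of_finite fun j =>
      isOpen_iInter_of_finite fun _ => isOpen_lt (continuous_apply i) (continuous_apply j)
  · exact isOpen_iInter_of_finite fun i =>
      (isOpen_lt continuous_const (continuous_apply i)).inter
        (isOpen_lt (continuous_apply i) continuous_const)

theorem volume_fundamentalAlcove_ne_zero (m : ℕ) : volume (fundamentalAlcove m) ≠ 0 := by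
  refine ((isOpen_fundamentalAlcove m).measure_pos volume ?_).ne'
  refine ⟨fun i => ((i : ℕ) + 1) / ((m : ℝ) + 1), fun i j hij => ?_, fun i => ⟨by positivity, ?_⟩⟩
  · have : ((i : ℕ) : ℝ) < (j : ℕ) := by exact_mod_cast hij
    exact div_lt_div_of_pos_right (by linarith) (by positivity)
  · rw [div_lt_one (by positivity)]
    have : ((i : ℕ) : ℝ) < m := by exact_mod_cast i.2
    linarith

theorem volume_fundamentalAlcove_ne_top (m : ℕ) : volume (fundamentalAlcove m) ≠ ∞ := by
  refine ((measure_mono fun a ha => ?_).trans_lt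
    (isCompact_Icc : IsCompact (Set.Icc (0 : Fin m → ℝ) 1)).measure_lt_top).ne
  exact ⟨fun i => (ha.2 i).1.le, fun i => (ha.2 i).2.le⟩

theorem measurePreserving_alcove {m : ℕ} (q : Fin m → ℤ) (ρ : Equiv.Perm (Fin m)) :
    MeasurePreserving (fun (y : Fin m → ℝ) (i : Fin m) => y (ρ.symm i) - q (ρ.symm i)) := by
  have h1 := measurePreserving_sub_right (volume : Measure (Fin m → ℝ)) (fun i => (q i : ℝ))
  have h2 := volume_measurePreserving_piCongrLeft (fun _ : Fin m => ℝ) ρ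
  have h3 : (fun (y : Fin m → ℝ) (i : Fin m) => y (ρ.symm i) - q (ρ.symm i)) =
      MeasurableEquiv.piCongrLeft (fun _ : Fin m => ℝ) ρ ∘ fun y => y - fun i => (q i : ℝ) := by
    funext y i
    obtain ⟨j, rfl⟩ := ρ.surjective i
    simp [MeasurableEquiv.coe_piCongrLeft, Equiv.piCongrLeft_apply_apply]
  rw [h3]
  exact h2.comp h1

theorem measurableSet_alcove {m : ℕ} (q : Fin m → ℤ) (ρ : Equiv.Perm (Fin m)) :
    MeasurableSet (alcove q ρ) :=
  (measurePreserving_alcove q ρ).measurable (isOpen_fundamentalAlcove m).measurableSet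

theorem volume_alcove {m : ℕ} (q : Fin m → ℤ) (ρ : Equiv.Perm (Fin m)) :
    volume (alcove q ρ) = volume (fundamentalAlcove m) :=
  (measurePreserving_alcove q ρ).measure_preimage
    (isOpen_fundamentalAlcove m).measurableSet.nullMeasurableSet

theorem floor_of_mem_alcove {m : ℕ} {q : Fin m → ℤ} {ρ : Equiv.Perm (Fin m)} {y : Fin m → ℝ}
    (hy : y ∈ alcove q ρ) (i : Fin m) : ⌊y i⌋ = q i := by
  have := hy.2 (ρ i)
  simp only [Equiv.symm_apply_apply, Set.mem_Ioo] at this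
  rw [Int.floor_eq_iff]
  exact ⟨by linarith, by linarith⟩

theorem disjoint_alcove {m : ℕ} {t t' : (Fin m → ℤ) × Equiv.Perm (Fin m)} (h : t ≠ t') :
    Disjoint (alcove t.1 t.2) (alcove t'.1 t'.2) := by
  rw [Set.disjoint_left]
  rintro y hy hy'
  obtain ⟨q, ρ⟩ := t
  obtain ⟨q', ρ'⟩ := t'
  obtain rfl : q = q' :=
    funext fun i => (floor_of_mem_alcove hy i).symm.trans (floor_of_mem_alcove hy' i)
  refine h (Prod.ext rfl ?_)
  have h1 : (fun i => y i - q i) ∘ ρ.symm = (fun i => y i - q i) ∘ ρ'.symm :=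
    Tuple.unique_monotone hy.1.monotone hy'.1.monotone
  refine Equiv.symm_bijective.injective (Equiv.ext fun i => ?_)
  have hinj : Function.Injective fun i => y i - (q i : ℝ) := by
    intro a b hab
    have := hy.1.injective (a₁ := ρ a) (a₂ := ρ b) (by simpa using hab)
    exact ρ.injective this
  exact hinj (congrFun h1 i)

/-- Points none of whose coordinates is an integer, and no two of whose coordinates differ by an
integer. -/
def IsGeneric {m : ℕ} (y : Fin m → ℝ) : Prop :=
  (∀ i (k : ℤ), y i ≠ k) ∧ ∀ i j, i ≠ j → ∀ k : ℤ, y i - y j ≠ k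

theorem volume_linearMap_eq_const {m : ℕ} (f : (Fin m → ℝ) →ₗ[ℝ] ℝ) (hf : f ≠ 0) (k : ℝ) :
    volume {y | f y = k} = 0 := by
  rcases Set.eq_empty_or_nonempty {y | f y = k} with h | ⟨p, hp⟩
  · rw [h, measure_empty]
  · have : {y | f y = k} = (fun y => y - p) ⁻¹' (f.ker : Set (Fin m → ℝ)) := by
      ext y
      rw [Set.mem_ofPred_eq] at hp
      simp [sub_eq_zero, hp]
    rw [this, (measurePreserving_sub_right volume p).measure_preimage
      (Submodule.closed_of_finiteDimensional _).measurableSet.nullMeasurableSet]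
    exact Measure.addHaar_submodule _ _ fun h => hf (LinearMap.ker_eq_top.mp h)

theorem ae_isGeneric (m : ℕ) : ∀ᵐ y : Fin m → ℝ, IsGeneric y := by
  refine Filter.Eventually.and ?_ ?_
  · simp only [Filter.eventually_all, ae_all_iff]
    intro i k
    have := volume_linearMap_eq_const (LinearMap.proj (R := ℝ) (φ := fun _ : Fin m => ℝ) i)
      (fun h => by simpa using LinearMap.congr_fun h (Pi.single i 1)) k
    simpa [ae_iff] using this
  · simp only [Filter.eventually_all, ae_all_iff]
    intro i j hij k
    have := volume_linearMap_eq_const (LinearMap.proj (R := ℝ) (φ := fun _ : Fin m => ℝ) i -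
      LinearMap.proj (R := ℝ) (φ := fun _ : Fin m => ℝ) j)
      (fun h => by simpa [hij] using LinearMap.congr_fun h (Pi.single i 1)) k
    simpa [ae_iff] using this

theorem IsGeneric.exists_mem_alcove {m : ℕ} {y : Fin m → ℝ} (hy : IsGeneric y) :
    ∃ t : (Fin m → ℤ) × Equiv.Perm (Fin m), y ∈ alcove t.1 t.2 := by
  have hinj : Function.Injective fun i => Int.fract (y i) := by
    intro i j hij
    by_contra hne
    obtain ⟨k, hk⟩ := Int.fract_eq_fract.mp hij
    exact hy.2 i j hne k hk
  refine ⟨(fun i => ⌊y i⌋, (Tuple.sort fun i => Int.fract (y i)).symm), ?_, fun i => ⟨?_, ?_⟩⟩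
  · exact (Tuple.monotone_sort fun i => Int.fract (y i)).strictMono_of_injective
      (hinj.comp (Equiv.injective _))
  · refine lt_of_le_of_ne (Int.fract_nonneg _) fun h0 => ?_
    exact hy.1 _ _ (sub_eq_zero.mp h0.symm)
  · exact Int.fract_lt_one _

/-- Integers `Q`, `Q'` together with ranks `r`, `r'` are compared lexicographically, both when a
rank `r` is replaced by a number `α r ∈ [0, 1)` and when it stands for `r / (m + 1)`. -/
theorem add_le_add_iff_of_strictMono {m : ℕ} {α : Fin (m + 1) → ℝ} (hα : StrictMono α)
    (h0 : ∀ r, 0 ≤ α r) (h1 : ∀ r, α r < 1) (Q Q' : ℤ) (r r' : Fin (m + 1)) :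
    (Q : ℝ) + α r ≤ Q' + α r' ↔
      (m + 1 : ℤ) * Q + (r : ℕ) ≤ (m + 1 : ℤ) * Q' + (r' : ℕ) := by
  have hr := r.2
  have hr' := r'.2
  rcases lt_trichotomy Q Q' with h | rfl | h
  · have h2 : (Q : ℝ) + 1 ≤ Q' := by exact_mod_cast h
    refine iff_of_true (by linarith [h1 r, h0 r']) ?_
    have : (m + 1 : ℤ) * (Q + 1) ≤ (m + 1) * Q' := by gcongr; omega
    nlinarith
  · rw [add_le_add_iff_left, add_le_add_iff_left, hα.le_iff_le, Nat.cast_le, Fin.val_fin_le]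
  · have h2 : (Q' : ℝ) + 1 ≤ Q := by exact_mod_cast h
    refine iff_of_false (by linarith [h1 r', h0 r]) ?_
    have : (m + 1 : ℤ) * (Q' + 1) ≤ (m + 1) * Q := by gcongr; omega
    nlinarith

/-- The ranks of the fractional parts of `0, y 0, …, y (m - 1)` for `y` in the alcove of `ρ`. -/
def alcoveRank {m : ℕ} (ρ : Equiv.Perm (Fin m)) : Fin (m + 1) → Fin (m + 1) :=
  Fin.cons 0 fun i => (ρ i).succ

theorem alcoveRank_injective {m : ℕ} (ρ : Equiv.Perm (Fin m)) :
    Function.Injective (alcoveRank ρ) := by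
  rw [alcoveRank, Fin.cons_injective_iff]
  refine ⟨fun ⟨i, hi⟩ => Fin.succ_ne_zero _ hi, fun i j h => ρ.injective (Fin.succ_injective _ h)⟩

/-- The integer sequence of an alcove: a point with integer part `q` whose fractional part has
rank `r` is replaced by `(m + 1) q + r`, and the sequence is extended by `c (m + 1)` per period. -/
def alcoveSeq {m : ℕ} (c : ℕ) (t : (Fin m → ℤ) × Equiv.Perm (Fin m)) : ℕ → ℤ :=
  periodicExt (fun j => (m + 1 : ℤ) * (Fin.cons 0 t.1 : Fin (m + 1) → ℤ) j + (alcoveRank t.2 j : ℕ))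
    (c * (m + 1))

theorem alcoveSeq_of_lt {m : ℕ} (c : ℕ) (t : (Fin m → ℤ) × Equiv.Perm (Fin m)) (i : Fin m) :
    alcoveSeq c t (i + 1) = (m + 1 : ℤ) * t.1 i + ((t.2 i : ℕ) + 1 : ℕ) := by
  rw [alcoveSeq, periodicExt_of_lt _ _ (Nat.succ_lt_succ i.2)]
  rfl

theorem periodicExt_le_iff_alcoveSeq_le {m : ℕ} {c : ℕ} {t : (Fin m → ℤ) × Equiv.Perm (Fin m)}
    {y : Fin m → ℝ} (hy : y ∈ alcove t.1 t.2) (k l : ℕ) (e : ℤ) :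
    periodicExt (Fin.cons 0 y : Fin (m + 1) → ℝ) c k ≤
        periodicExt (Fin.cons 0 y : Fin (m + 1) → ℝ) c l + e ↔
      alcoveSeq c t k ≤ alcoveSeq c t l + e * (m + 1) := by
  set a : Fin m → ℝ := fun i => y (t.2.symm i) - t.1 (t.2.symm i) with ha
  set α : Fin (m + 1) → ℝ := Fin.cons 0 a with hα
  have hmono : StrictMono α := by
    refine fun i j => Fin.cases ?_ (fun i => ?_) i
    · refine Fin.cases (fun h => absurd h (lt_irrefl _)) (fun j _ => ?_) j
      exact (hy.2 j).1
    · refine Fin.cases (fun h => absurd h (Fin.not_lt_zero _)) (fun j h => ?_) j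
      exact hy.1 (Fin.succ_lt_succ_iff.mp h)
  have h0 : ∀ r, 0 ≤ α r := Fin.cases le_rfl fun i => (hy.2 i).1.le
  have h1 : ∀ r, α r < 1 := Fin.cases one_pos fun i => (hy.2 i).2
  have hcons : ∀ j, (Fin.cons 0 y : Fin (m + 1) → ℝ) j =
      (Fin.cons 0 t.1 : Fin (m + 1) → ℤ) j + α (alcoveRank t.2 j) := by
    refine Fin.cases ?_ fun i => ?_
    · simp [alcoveRank, hα]
    · simp [alcoveRank, hα, ha]
  have key := add_le_add_iff_of_strictMono hmono h0 h1
    ((Fin.cons 0 t.1 : Fin (m + 1) → ℤ) ⟨k % (m + 1), Nat.mod_lt _ m.succ_pos⟩ +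
      (k / (m + 1) : ℕ) * c)
    ((Fin.cons 0 t.1 : Fin (m + 1) → ℤ) ⟨l % (m + 1), Nat.mod_lt _ m.succ_pos⟩ +
      (l / (m + 1) : ℕ) * c + e)
    (alcoveRank t.2 ⟨k % (m + 1), Nat.mod_lt _ m.succ_pos⟩)
    (alcoveRank t.2 ⟨l % (m + 1), Nat.mod_lt _ m.succ_pos⟩)
  simp only [periodicExt, alcoveSeq, hcons]
  generalize k / (m + 1) = k' at key ⊢
  generalize l / (m + 1) = l' at key ⊢
  push_cast at key
  constructor
  · intro h
    have := key.mp (by linarith)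
    linarith
  · intro h
    have := key.mpr (by linarith)
    linarith

/-! ### The slice in partial-sum coordinates -/

/-- The slice in partial-sum coordinates: the differences of the sequence
`0, y 0, …, y (m - 1), c` lie in `[0, d]`. -/
def partialSumPolytope (m c d : ℕ) : Set (Fin m → ℝ) :=
  {y | ∀ i < m + 1,
    periodicExt (Fin.cons 0 y : Fin (m + 1) → ℝ) c i ≤
        periodicExt (Fin.cons 0 y : Fin (m + 1) → ℝ) c (i + 1) ∧
      periodicExt (Fin.cons 0 y : Fin (m + 1) → ℝ) c (i + 1) ≤
        periodicExt (Fin.cons 0 y : Fin (m + 1) → ℝ) c i + d}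

theorem alcoveSeq_add_period {m : ℕ} (c : ℕ) (t : (Fin m → ℤ) × Equiv.Perm (Fin m)) (i : ℕ) :
    alcoveSeq c t (i + (m + 1)) = alcoveSeq c t i + c * (m + 1) :=
  periodicExt_add_period _ _ _

theorem modEq_of_dvd_alcoveSeq {m : ℕ} (c : ℕ) (t : (Fin m → ℤ) × Equiv.Perm (Fin m)) (i j : ℕ)
    (h : ((m + 1 : ℕ) : ℤ) ∣ alcoveSeq c t i - alcoveSeq c t j) : i ≡ j [MOD m + 1] := by
  have hmod : ∀ k, alcoveSeq c t k % ((m + 1 : ℕ) : ℤ) =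
      (alcoveRank t.2 ⟨k % (m + 1), Nat.mod_lt _ m.succ_pos⟩ : ℕ) := by
    intro k
    have hlt := (alcoveRank t.2 ⟨k % (m + 1), Nat.mod_lt _ m.succ_pos⟩).2
    rw [alcoveSeq, periodicExt]
    generalize alcoveRank t.2 ⟨k % (m + 1), Nat.mod_lt _ m.succ_pos⟩ = r at hlt ⊢
    generalize (Fin.cons 0 t.1 : Fin (m + 1) → ℤ) _ = q
    have : (m + 1 : ℤ) * q + (r : ℕ) + ((k / (m + 1) : ℕ) : ℤ) * (c * (m + 1)) =
        (r : ℕ) + ((m + 1 : ℕ) : ℤ) * (q + (k / (m + 1) : ℕ) * c) := by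
      push_cast; ring
    rw [this, Int.add_mul_emod_self_left]
    exact Int.emod_eq_of_lt (by positivity) (by exact_mod_cast hlt)
  have h1 := Int.emod_eq_emod_iff_emod_sub_eq_zero.mpr (Int.emod_eq_zero_of_dvd h)
  rw [hmod, hmod, Nat.cast_inj, Fin.val_inj, (alcoveRank_injective t.2).eq_iff, Fin.mk.injEq] at h1
  exact h1

/-- An alcove lies in the slice if its integer sequence is a ladder, and is disjoint from the slice
otherwise. -/
theorem mem_partialSumPolytope_iff_isLadder {m c d : ℕ} (hc : 0 < c) (hlt : c < d * (m + 1))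
    {t : (Fin m → ℤ) × Equiv.Perm (Fin m)} {y : Fin m → ℝ} (hy : y ∈ alcove t.1 t.2) :
    y ∈ partialSumPolytope m c d ↔ IsLadder (m + 1) c d (alcoveSeq c t) := by
  have hle : ∀ i, (periodicExt (Fin.cons 0 y : Fin (m + 1) → ℝ) c i ≤
        periodicExt (Fin.cons 0 y : Fin (m + 1) → ℝ) c (i + 1)) ↔
      alcoveSeq c t i ≤ alcoveSeq c t (i + 1) := fun i => by
    have := periodicExt_le_iff_alcoveSeq_le (c := c) hy i (i + 1) 0
    simpa using this
  have hle' : ∀ i, (periodicExt (Fin.cons 0 y : Fin (m + 1) → ℝ) c (i + 1) ≤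
        periodicExt (Fin.cons 0 y : Fin (m + 1) → ℝ) c i + d) ↔
      alcoveSeq c t (i + 1) ≤ alcoveSeq c t i + d * (m + 1) := fun i => by
    have := periodicExt_le_iff_alcoveSeq_le (c := c) hy (i + 1) i d
    simpa using this
  simp only [partialSumPolytope, Set.mem_ofPred_eq, hle, hle']
  constructor
  · intro h
    have hper := alcoveSeq_add_period c t
    -- The weak inequalities are strict because consecutive terms are incongruent modulo `m + 1`.
    have hstrict : ∀ i < m + 1, alcoveSeq c t i < alcoveSeq c t (i + 1) ∧
        alcoveSeq c t (i + 1) < alcoveSeq c t i + d * (m + 1) := by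
      intro i hi
      obtain ⟨h1, h2⟩ := h i hi
      rcases Nat.eq_zero_or_pos m with rfl | hm
      · have h3 := hper i
        have h4 : (c : ℤ) < d := by exact_mod_cast (by simpa using hlt)
        have h5 : (0 : ℤ) < c := by exact_mod_cast hc
        simp only [zero_add, Nat.cast_zero, mul_one] at h3 ⊢
        constructor <;> linarith
      · have hne : ∀ k : ℤ, alcoveSeq c t (i + 1) - alcoveSeq c t i ≠ ((m + 1 : ℕ) : ℤ) * k := by
          intro k hk
          have h3 := modEq_of_dvd_alcoveSeq c t _ _ ⟨k, hk⟩
          have h4 := (Nat.modEq_iff_dvd' (Nat.le_succ i)).mp h3.symm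
          rw [Nat.succ_eq_add_one, Nat.add_sub_cancel_left] at h4
          have := Nat.le_of_dvd one_pos h4
          omega
        refine ⟨lt_of_le_of_ne h1 fun h3 => hne 0 ?_, lt_of_le_of_ne h2 fun h3 => hne d ?_⟩
        · rw [h3]; ring
        · rw [h3]; push_cast; ring
    have hall : ∀ i, alcoveSeq c t i < alcoveSeq c t (i + 1) ∧
        alcoveSeq c t (i + 1) < alcoveSeq c t i + d * (m + 1) := by
      intro i
      induction i using Nat.strong_induction_on with
      | _ i ih =>
        rcases lt_or_ge i (m + 1) with hi | hi
        · exact hstrict i hi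
        · obtain ⟨l, rfl⟩ := Nat.exists_eq_add_of_le' hi
          have := ih l (by omega)
          rw [add_right_comm, hper, hper]
          exact ⟨by linarith, by linarith⟩
    exact
      { zero := by rw [alcoveSeq, periodicExt_zero]; simp [alcoveRank]
        add_period := fun i => by rw [hper]; push_cast; ring
        lt_succ := fun i => (hall i).1
        succ_lt := fun i => by have := (hall i).2; push_cast; exact this
        modEq := modEq_of_dvd_alcoveSeq c t }
  · intro h i _
    have := h.succ_lt i
    push_cast at this
    exact ⟨(h.lt_succ i).le, this.le⟩

theorem alcoveSeq_injective {m c : ℕ} : Function.Injective (alcoveSeq (m := m) c) := by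
  have hdiv : ∀ (t : (Fin m → ℤ) × Equiv.Perm (Fin m)) (i : Fin m),
      alcoveSeq c t (i + 1) / (m + 1 : ℤ) = t.1 i ∧
        alcoveSeq c t (i + 1) % (m + 1 : ℤ) = ((t.2 i : ℕ) + 1 : ℕ) := by
    intro t i
    have h1 := (t.2 i).2
    rw [Int.ediv_emod_unique (by positivity), alcoveSeq_of_lt]
    refine ⟨by ring, by positivity, by exact_mod_cast Nat.succ_lt_succ h1⟩
  intro t t' h
  refine Prod.ext (funext fun i => ?_) (Equiv.ext fun i => Fin.ext ?_)
  · rw [← (hdiv t i).1, ← (hdiv t' i).1, h]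
  · have := (hdiv t i).2
    rw [h, (hdiv t' i).2] at this
    have : (t'.2 i : ℕ) + 1 = (t.2 i : ℕ) + 1 := by exact_mod_cast this
    omega

theorem IsLadder.exists_alcoveSeq {m c d : ℕ} {W : ℕ → ℤ} (h : IsLadder (m + 1) c d W) :
    ∃ t : (Fin m → ℤ) × Equiv.Perm (Fin m), alcoveSeq c t = W := by
  have hpos : (0 : ℤ) < m + 1 := by positivity
  have hnn : ∀ i : ℕ, 0 ≤ W i % (m + 1 : ℤ) := fun i => Int.emod_nonneg _ hpos.ne'
  have hlt : ∀ i : ℕ, W i % (m + 1 : ℤ) < m + 1 := fun i => Int.emod_lt_of_pos _ hpos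
  have hinj : ∀ i j : ℕ, i < m + 1 → j < m + 1 → W i % (m + 1 : ℤ) = W j % (m + 1 : ℤ) → i = j := by
    intro i j hi hj hij
    have h1 := h.modEq i j (by
      push_cast
      exact Int.dvd_of_emod_eq_zero (Int.emod_eq_emod_iff_emod_sub_eq_zero.mp hij))
    exact Nat.ModEq.eq_of_lt_of_lt h1 hi hj
  have h1 : ∀ i : Fin m, 1 ≤ W (i + 1) % (m + 1 : ℤ) := by
    intro i
    refine lt_of_le_of_ne (hnn _) fun h0 => ?_
    have := hinj 0 (i + 1) (by omega) (by omega) (by rw [h.zero, ← h0]; simp)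
    omega
  have hrinj : Function.Injective fun i : Fin m =>
      (⟨(W (i + 1) % (m + 1 : ℤ) - 1).toNat, by have := h1 i; have := hlt (i + 1); omega⟩ :
        Fin m) := by
    intro i j hij
    rw [Fin.mk.injEq] at hij
    have := h1 i
    have := h1 j
    have := hinj (i + 1) (j + 1) (by omega) (by omega) (by omega)
    exact Fin.ext (by omega)
  refine ⟨(fun i => W (i + 1) / (m + 1 : ℤ),
    Equiv.ofBijective _ (Finite.injective_iff_bijective.mp hrinj)), ?_⟩
  refine (eq_periodicExt _ _ (fun k => ?_) (Fin.cases ?_ fun i => ?_)).symm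
  · rw [h.add_period]; push_cast; ring
  · simp [alcoveRank, h.zero]
  · simp only [Fin.val_succ, Fin.cons_succ, alcoveRank, Equiv.ofBijective_apply]
    have := h1 i
    push_cast
    rw [Int.toNat_of_nonneg (by omega)]
    have := Int.mul_ediv_add_emod (W (i + 1)) (m + 1)
    linarith

/-- The slice is, up to a null set, a disjoint union of alcoves, one for each ladder. -/
theorem volume_partialSumPolytope {m c d : ℕ} (hc : 0 < c) (hlt : c < d * (m + 1)) :
    volume (partialSumPolytope m c d) =
      (ENat.card {W // IsLadder (m + 1) c d W} : ℝ≥0∞) * volume (fundamentalAlcove m) := by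
  let T := {t : (Fin m → ℤ) × Equiv.Perm (Fin m) // IsLadder (m + 1) c d (alcoveSeq c t)}
  have hae : partialSumPolytope m c d =ᵐ[volume] ⋃ t : T, alcove t.1.1 t.1.2 := by
    filter_upwards [ae_isGeneric m] with y hy
    obtain ⟨t, ht⟩ := hy.exists_mem_alcove
    refine propext ?_
    change y ∈ partialSumPolytope m c d ↔ y ∈ ⋃ t : T, alcove t.1.1 t.1.2
    rw [Set.mem_iUnion]
    constructor
    · intro h
      exact ⟨⟨t, (mem_partialSumPolytope_iff_isLadder hc hlt ht).mp h⟩, ht⟩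
    · rintro ⟨t', ht'⟩
      exact (mem_partialSumPolytope_iff_isLadder hc hlt ht').mpr t'.2
  have hcard : ENat.card T = ENat.card {W // IsLadder (m + 1) c d W} := by
    refine ENat.card_congr (Equiv.ofBijective (fun t => ⟨alcoveSeq c t.1, t.2⟩) ⟨?_, ?_⟩)
    · intro t t' h
      exact Subtype.ext (alcoveSeq_injective (congrArg Subtype.val h))
    · rintro ⟨W, h⟩
      obtain ⟨t, rfl⟩ := h.exists_alcoveSeq
      exact ⟨⟨t, h⟩, rfl⟩
  rw [measure_congr hae, measure_iUnion
    (fun t t' h => disjoint_alcove fun h0 => h (Subtype.ext h0))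
    (fun t => measurableSet_alcove _ _)]
  simp_rw [volume_alcove]
  rw [ENNReal.tsum_const, hcard]

/-- In partial-sum coordinates the standard simplex is the closure of the fundamental alcove. -/
theorem volume_partialSumPolytope_one_one (m : ℕ) :
    volume (partialSumPolytope m 1 1) = volume (fundamentalAlcove m) := by
  refine measure_congr ?_
  filter_upwards [ae_isGeneric m] with y hy
  refine propext ?_
  change y ∈ partialSumPolytope m 1 1 ↔ y ∈ fundamentalAlcove m
  set E := periodicExt (Fin.cons 0 y : Fin (m + 1) → ℝ) (1 : ℕ) with hE
  have hE0 : E 0 = 0 := periodicExt_zero _ _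
  have hEn : E (m + 1) = 1 := by rw [hE, periodicExt_period]; simp
  have hEs : ∀ i : Fin m, E (i + 1) = y i := fun i => periodicExt_cons_succ _ y i.2
  constructor
  · intro h
    have hmono : ∀ k l, k ≤ l → l ≤ m + 1 → E k ≤ E l := by
      intro k l hkl
      induction l, hkl using Nat.le_induction with
      | base => exact fun _ => le_rfl
      | succ l _ ih => exact fun hl => (ih (by omega)).trans (h l (by omega)).1
    refine ⟨fun i j hij => ?_, fun i => ⟨?_, ?_⟩⟩
    · have h1 := hmono (i + 1) (j + 1) (by have : (i : ℕ) < j := hij; omega) (by omega)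
      rw [hEs, hEs] at h1
      exact lt_of_le_of_ne h1 fun h2 => hy.2 i j hij.ne 0 (by simp [h2])
    · have h1 := hmono 0 (i + 1) (by omega) (by omega)
      rw [hE0, hEs] at h1
      exact lt_of_le_of_ne h1 fun h2 => hy.1 i 0 (by simp [← h2])
    · have h1 := hmono (i + 1) (m + 1) (by omega) le_rfl
      rw [hEn, hEs] at h1
      exact lt_of_le_of_ne h1 fun h2 => hy.1 i 1 (by simp [h2])
  · intro h i hi
    change E i ≤ E (i + 1) ∧ E (i + 1) ≤ E i + ((1 : ℕ) : ℝ)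
    rw [Nat.cast_one]
    rcases Nat.eq_zero_or_pos i with rfl | hi0
    · rw [hE0]
      rcases Nat.eq_zero_or_pos m with rfl | hm
      · rw [hEn]; norm_num
      · have h1 := hEs ⟨0, hm⟩
        have h2 := h.2 ⟨0, hm⟩
        simp only [zero_add, Set.mem_Ioo] at h1 h2 ⊢
        rw [h1]
        constructor <;> linarith
    · obtain ⟨j, rfl⟩ := Nat.exists_eq_add_of_le' hi0
      have h1 := hEs ⟨j, by omega⟩
      have h2 := h.2 ⟨j, by omega⟩
      simp only [Set.mem_Ioo] at h1 h2
      rw [h1]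
      rcases Nat.lt_or_ge (j + 1) m with hj | hj
      · have h3 := hEs ⟨j + 1, hj⟩
        have h4 := h.2 ⟨j + 1, hj⟩
        have h5 : y ⟨j, by omega⟩ < y ⟨j + 1, hj⟩ := h.1 (Nat.lt_succ_self j)
        simp only [Set.mem_Ioo] at h3 h4
        rw [h3]
        constructor <;> linarith
      · obtain rfl : m = j + 1 := by omega
        rw [hEn]
        constructor <;> linarith

/-! ### Volume in the hyperplane -/

/-- The point of the hyperplane `x_0 + ⋯ + x_m = c` with the partial sums `y`. -/
noncomputable def ofPartialSums {m : ℕ} (c : ℝ) (y : Fin m → ℝ) : EuclideanSpace ℝ (Fin (m + 1)) :=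
  WithLp.toLp 2 fun i => periodicExt (Fin.cons 0 y : Fin (m + 1) → ℝ) c (i + 1) -
    periodicExt (Fin.cons 0 y : Fin (m + 1) → ℝ) c i

theorem ofPartialSums_apply {m : ℕ} (c : ℝ) (y : Fin m → ℝ) (i : Fin (m + 1)) :
    ofPartialSums c y i = periodicExt (Fin.cons 0 y : Fin (m + 1) → ℝ) c (i + 1) -
      periodicExt (Fin.cons 0 y : Fin (m + 1) → ℝ) c i := rfl

theorem sum_ofPartialSums {m : ℕ} (c : ℝ) (y : Fin m → ℝ) : ∑ i, ofPartialSums c y i = c := by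
  simp_rw [ofPartialSums_apply]
  rw [Fin.sum_univ_eq_sum_range (fun k => periodicExt (Fin.cons 0 y : Fin (m + 1) → ℝ) c (k + 1) -
    periodicExt (Fin.cons 0 y : Fin (m + 1) → ℝ) c k), Finset.sum_range_sub, periodicExt_period,
    periodicExt_zero]
  simp

theorem exists_ofPartialSums {m : ℕ} {c : ℝ} {x : EuclideanSpace ℝ (Fin (m + 1))}
    (hx : ∑ i, x i = c) : ∃ y, ofPartialSums c y = x := by
  let f : ℕ → ℝ := fun k => if h : k < m + 1 then x ⟨k, h⟩ else 0
  have hf : ∀ i : Fin (m + 1), f i = x i := fun i => dif_pos i.2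
  have hsum : ∑ k ∈ Finset.range (m + 1), f k = c := by
    rw [← hx, ← Fin.sum_univ_eq_sum_range]
    exact Finset.sum_congr rfl fun i _ => hf i
  refine ⟨fun j => ∑ k ∈ Finset.range (j + 1), f k, ?_⟩
  have hE : ∀ k ≤ m + 1, periodicExt (Fin.cons 0 fun j : Fin m =>
      ∑ k ∈ Finset.range (j + 1), f k : Fin (m + 1) → ℝ) c k = ∑ l ∈ Finset.range k, f l := by
    intro k hk
    rcases Nat.eq_zero_or_pos k with rfl | hk0
    · simp [periodicExt_zero]
    · obtain ⟨j, rfl⟩ := Nat.exists_eq_add_of_le' hk0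
      rcases Nat.lt_or_ge j m with hj | hj
      · rw [periodicExt_cons_succ _ _ hj]
      · obtain rfl : j = m := by omega
        rw [periodicExt_period, hsum]
        simp
  ext i
  rw [ofPartialSums_apply, hE _ (by omega), hE _ (by omega), Finset.sum_range_succ,
    add_sub_cancel_left, hf]

theorem slice_eq_image_ofPartialSums (m c d : ℕ) :
    {x : EuclideanSpace ℝ (Fin (m + 1)) | (∀ i, x i ∈ Set.Icc (0 : ℝ) d) ∧ ∑ i, x i = c} =
      ofPartialSums (c : ℝ) '' partialSumPolytope m c d := by
  have key : ∀ y : Fin m → ℝ, (∀ i, ofPartialSums (c : ℝ) y i ∈ Set.Icc (0 : ℝ) d) ↔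
      y ∈ partialSumPolytope m c d := by
    intro y
    simp only [ofPartialSums_apply, partialSumPolytope, Set.mem_ofPred_eq, Set.mem_Icc,
      sub_nonneg, sub_le_iff_le_add', Fin.forall_iff]
  ext x
  constructor
  · rintro ⟨h1, h2⟩
    obtain ⟨y, rfl⟩ := exists_ofPartialSums h2
    exact ⟨y, (key y).mp h1, rfl⟩
  · rintro ⟨y, hy, rfl⟩
    exact ⟨(key y).mpr hy, sum_ofPartialSums _ _⟩

/-- The linear part of `ofPartialSums`, onto the hyperplane `x_0 + ⋯ + x_m = 0`. -/
noncomputable def ofPartialSumsLinear (m : ℕ) :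
    (Fin m → ℝ) →ₗ[ℝ] EuclideanSpace ℝ (Fin (m + 1)) where
  toFun := ofPartialSums 0
  map_add' y z := by
    have h : ∀ j, (Fin.cons 0 (y + z) : Fin (m + 1) → ℝ) j =
        (Fin.cons 0 y : Fin (m + 1) → ℝ) j + (Fin.cons 0 z : Fin (m + 1) → ℝ) j :=
      Fin.cases (by simp) fun i => by simp
    ext i
    simp only [ofPartialSums_apply, PiLp.add_apply, periodicExt, h]
    ring
  map_smul' r y := by
    have h : ∀ j, (Fin.cons 0 (r • y) : Fin (m + 1) → ℝ) j =
        r * (Fin.cons 0 y : Fin (m + 1) → ℝ) j :=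
      Fin.cases (by simp) fun i => by simp
    ext i
    simp only [ofPartialSums_apply, PiLp.smul_apply, periodicExt, h, smul_eq_mul, RingHom.id_apply]
    ring

theorem ofPartialSums_eq_add {m : ℕ} (c : ℝ) (y : Fin m → ℝ) :
    ofPartialSums c y = ofPartialSums c 0 + ofPartialSumsLinear m y := by
  have h : ∀ j, (Fin.cons 0 (0 : Fin m → ℝ) : Fin (m + 1) → ℝ) j = 0 :=
    Fin.cases (by simp) fun i => by simp
  ext i
  change _ = ofPartialSums c 0 i + ofPartialSums 0 y i
  simp only [ofPartialSums_apply, periodicExt, h]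
  ring

theorem ofPartialSums_injective {m : ℕ} (c : ℝ) :
    Function.Injective (ofPartialSums (m := m) c) := by
  intro y z h
  have hE : ∀ k ≤ m, periodicExt (Fin.cons 0 y : Fin (m + 1) → ℝ) c k =
      periodicExt (Fin.cons 0 z : Fin (m + 1) → ℝ) c k := by
    intro k
    induction k with
    | zero => simp [periodicExt_zero]
    | succ k ih =>
      intro hk
      have h1 := congrFun (congrArg WithLp.ofLp h) ⟨k, by omega⟩
      rw [ofPartialSums_apply, ofPartialSums_apply] at h1
      have := ih (by omega)
      simp only at h1
      linarith
  funext i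
  have := hE (i + 1) i.2
  rwa [periodicExt_cons_succ _ _ i.2, periodicExt_cons_succ _ _ i.2] at this

/-- Partial-sum coordinates are affine, so up to a constant factor, the same for all hyperplanes
`x_0 + ⋯ + x_m = c`, they turn `m`-dimensional volume into Lebesgue measure. -/
theorem exists_hausdorffMeasure_image_ofPartialSums (m : ℕ) :
    ∃ C : ℝ≥0∞, C ≠ 0 ∧ C ≠ ∞ ∧ ∀ (c : ℝ) (B : Set (Fin m → ℝ)),
      μH[(m : ℝ)] (ofPartialSums c '' B) = C * volume B := by
  have hker : (ofPartialSumsLinear m).ker = ⊥ :=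
    LinearMap.ker_eq_bot.mpr (ofPartialSums_injective 0)
  have hemb : MeasurableEmbedding (ofPartialSumsLinear m) :=
    (LinearMap.isClosedEmbedding_of_injective hker).measurableEmbedding
  have hvol : (μH[(m : ℝ)] : Measure (Fin m → ℝ)) = volume := by
    have := hausdorffMeasure_pi_real (ι := Fin m)
    rwa [Fintype.card_fin] at this
  let ν : Measure (Fin m → ℝ) := Measure.comap (ofPartialSumsLinear m) μH[(m : ℝ)]
  have hν : ∀ B, ν B = μH[(m : ℝ)] (ofPartialSumsLinear m '' B) := hemb.comap_apply _
  have hinv : ν.IsAddLeftInvariant := by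
    refine ⟨fun p => Measure.ext fun B hB => ?_⟩
    rw [Measure.map_apply (measurable_const_add p) hB, hν, hν]
    have h1 : (fun y => p + y) ⁻¹' B = (fun y => -p + y) '' B := by
      rw [Set.image_add_left, neg_neg]
    have h2 : ofPartialSumsLinear m '' ((fun y => -p + y) '' B) =
        (ofPartialSumsLinear m (-p)) +ᵥ (ofPartialSumsLinear m '' B) := by
      rw [← Set.image_vadd, Set.image_image, Set.image_image]
      simp only [map_add, vadd_eq_add]
    rw [h1, h2, measure_vadd]
  have hfin : IsFiniteMeasureOnCompacts ν := by
    refine ⟨fun K hK => ?_⟩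
    have hlip := (LinearMap.toContinuousLinearMap (ofPartialSumsLinear m)).lipschitz
    have := hlip.hausdorffMeasure_image_le (d := m) (by positivity) K
    rw [hvol] at this
    rw [hν]
    refine this.trans_lt (ENNReal.mul_lt_top ?_ hK.measure_lt_top)
    exact ENNReal.rpow_lt_top_of_nonneg (by positivity) ENNReal.coe_ne_top
  have hsmul := Measure.isAddLeftInvariant_eq_smul ν volume
  refine ⟨ν.addHaarScalarFactor volume, fun h0 => ?_, ENNReal.coe_ne_top, fun c B => ?_⟩
  · obtain ⟨K, -, hK⟩ := LinearMap.exists_antilipschitzWith (ofPartialSumsLinear m) hker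
    have h1 := hK.le_hausdorffMeasure_image (d := m) (by positivity) Set.univ
    rw [← hν, hsmul, hvol] at h1
    rw [ENNReal.coe_eq_zero] at h0
    rw [h0, zero_smul] at h1
    simp only [Measure.coe_zero, Pi.zero_apply, mul_zero, nonpos_iff_eq_zero,
      Measure.measure_univ_eq_zero] at h1
    exact volume_fundamentalAlcove_ne_zero m (by rw [h1]; rfl)
  · have h1 : ofPartialSums c '' B = ofPartialSums (m := m) c 0 +ᵥ (ofPartialSumsLinear m '' B) := by
      rw [← Set.image_vadd, Set.image_image]
      exact Set.image_congr fun y _ => ofPartialSums_eq_add c y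
    rw [h1, measure_vadd, ← hν]
    exact DFunLike.congr_fun hsmul B

/-! ### The normalized volume of the slice -/

theorem slice_eq_smul_hypersimplex (n c d : ℕ) (hd : 0 < d) :
    {x : EuclideanSpace ℝ (Fin n) | (∀ i, x i ∈ Set.Icc (0 : ℝ) d) ∧ ∑ i, x i = c} =
      (d : ℝ) • hypersimplex ((c : ℝ) / d) n := by
  have hd' : (0 : ℝ) < d := by exact_mod_cast hd
  ext x
  rw [Set.mem_smul_set_iff_inv_smul_mem₀ hd'.ne']
  simp only [hypersimplex, Set.mem_ofPred_eq, PiLp.smul_apply, smul_eq_mul, Set.mem_Icc,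
    ← Finset.mul_sum]
  rw [and_comm, inv_mul_eq_div, div_left_inj' hd'.ne']
  refine and_congr_right fun _ => forall_congr' fun i => ?_
  rw [inv_mul_eq_div, div_le_one hd']
  exact and_congr_left fun _ => (le_div_iff₀ hd').trans (by rw [zero_mul]) |>.symm

theorem normalizedVolume_slice {m c d : ℕ} (hc : 0 < c) (hlt : c < d * (m + 1)) :
    normalizedVolume {x : EuclideanSpace ℝ (Fin (m + 1)) |
      (∀ i, x i ∈ Set.Icc (0 : ℝ) d) ∧ ∑ i, x i = c} =
        (ENat.card {W // IsLadder (m + 1) c d W} : ℝ≥0∞) := by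
  obtain ⟨C, hC0, hCtop, hC⟩ := exists_hausdorffMeasure_image_ofPartialSums m
  have hsimplex : hypersimplex 1 (m + 1) =
      ofPartialSums ((1 : ℕ) : ℝ) '' partialSumPolytope m 1 1 := by
    have := slice_eq_smul_hypersimplex (m + 1) 1 1 one_pos
    rw [slice_eq_image_ofPartialSums] at this
    rw [this]
    simp
  rw [normalizedVolume, slice_eq_image_ofPartialSums, hsimplex, Nat.add_sub_cancel, hC, hC,
    volume_partialSumPolytope hc hlt, volume_partialSumPolytope_one_one]
  rw [mul_left_comm]
  exact ENNReal.mul_div_cancel_right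
    (mul_ne_zero hC0 (volume_fundamentalAlcove_ne_zero m))
    (ENNReal.mul_ne_top hCtop (volume_fundamentalAlcove_ne_top m))

theorem refinedEulerian_eq {n c d : ℕ} (hd : 0 < d) (hn : 0 < n) (hc : 0 < c) :
    refinedEulerian d (d * n - 1) (c - 1) = Nat.card {σ : CircularPerm (d * n) //
      σ.cyclicDescents = c ∧ σ.addLetters ((n : ℕ) : ZMod (d * n)) = σ} := by
  have hN : d * n - 1 + 1 = d * n := Nat.sub_add_cancel (Nat.mul_pos hd hn)
  rw [refinedEulerian, hN, Nat.sub_add_cancel hc, Nat.mul_div_cancel_left n hd]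

theorem mainTheorem2 (n c d : ℕ) (hd : 0 < d) (hcd : Nat.Coprime c d)
    (hpos : 0 < (c : ℝ) / d) (hlt : (c : ℝ) / d < n) :
    {x : EuclideanSpace ℝ (Fin n) | (∀ i, x i ∈ Set.Icc (0 : ℝ) d) ∧ ∑ i, x i = c} =
        (d : ℝ) • hypersimplex ((c : ℝ) / d) n ∧
      normalizedVolume ((d : ℝ) • hypersimplex ((c : ℝ) / d) n) =
        (refinedEulerian d (d * n - 1) (c - 1) : ℝ≥0∞) := by
  refine ⟨slice_eq_smul_hypersimplex n c d hd, ?_⟩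
  have hd' : (0 : ℝ) < d := by exact_mod_cast hd
  have hc : 0 < c := by
    refine Nat.pos_of_ne_zero fun h0 => ?_
    simp [h0] at hpos
  have hlt' : c < d * n := by
    rw [div_lt_iff₀ hd', mul_comm] at hlt
    exact_mod_cast hlt
  have hn : 0 < n := Nat.pos_of_ne_zero fun h0 => by simp [h0] at hlt'
  obtain ⟨m, rfl⟩ := Nat.exists_eq_add_of_le' hn
  replace hlt' : c < d * (m + 1) := hlt'
  have : NeZero (d * (m + 1)) := ⟨(Nat.mul_pos hd hn).ne'⟩
  rw [← slice_eq_smul_hypersimplex _ c d hd, normalizedVolume_slice hc hlt',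
    card_isLadder hcd (by omega), refinedEulerian_eq hd hn hc]
  rfl
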